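/- Let $\mathbb{L}_{\ge 0}=\omega_1\times[0,1)$ be the long ray, with the topology given by the lexicographic order, and let $\mathbb{L}_+=\mathbb{L}_{\ge 0}-\{\langle 0,0\rangle\}$; regard $\omega_1$ as a subset of $\mathbb{L}_{\ge 0}$ by identifying $\alpha$ with $\langle\alpha,0\rangle$. An $n$-manifold is a Hausdorff space each of whose points has a neighborhood homeomorphic to $\mathbb{R}^{n-1}\times\mathbb{R}_{\ge 0}$; its boundary consists of the points that have no neighborhood homeomorphic to $\mathbb{R}^n$; a surface is a $2$-manifold. A closed subset $B$ of a space $X$ is collared in $X$ if there is an embedding $h:B\times[0,1]\to X$ with $h(x,0)=x$ for all $x\in B$, such that $h^{-1}(B)=B\times\{0\}$ and $h(B\times[0,1))$ is open in $X$; it is strongly collared if moreover $h$ can be chosen to be a closed embedding. A $0$-set in $X$ is a set of the form $f^{-1}(\{0\})$ with $f:X\to\mathbb{R}$ continuous. Then $S=\mathbb{L}_+\times[0,2)-\omega_1\times\{0\}$, with the subspace topology, is a surface. Its boundary is $\partial S=(\mathbb{L}_+-\omega_1)\times\{0\}$, which is homeomorphic to the topological disjoint union of $\omega_1$ many copies of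 the open interval $(0,1)$. The boundary $\partial S$ is collared in $S$ and is a $0$-set in $S$, but it is not strongly collared in $S$. -/

import Mathlib

/-! ### Topological manifolds with boundary, zero-sets and collars -/

/-- An `n`-manifold (with boundary, not assumed metrisable, second countable or connected): a
Hausdorff space each of whose points has a neighbourhood homeomorphic to the closed half-space
`ℝⁿ⁻¹ × ℝ≥0`. -/
def IsTopManifold (n : ℕ) [NeZero n] (M : Type*) [TopologicalSpace M] : Prop :=
  T2Space M ∧ ∀ x : M, ∃ N ∈ nhds x, Nonempty (N ≃ₜ EuclideanHalfSpace n)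

/-- A surface is a `2`-manifold. -/
def IsSurface (M : Type*) [TopologicalSpace M] : Prop :=
  IsTopManifold 2 M

/-- The boundary of an `n`-manifold: the points that have no neighbourhood homeomorphic
to `ℝⁿ`. -/
def manifoldBoundary (n : ℕ) (M : Type*) [TopologicalSpace M] : Set M :=
  {x | ¬ ∃ N ∈ nhds x, Nonempty (N ≃ₜ EuclideanSpace ℝ (Fin n))}

/-- A `0`-set: the inverse image of `{0}` under a continuous real-valued function. -/
def IsZeroSet {X : Type*} [TopologicalSpace X] (A : Set X) : Prop :=
  ∃ f : X → ℝ, Continuous f ∧ f ⁻¹' {0} = A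

/-- `h : B × [0,1] → X` is a collar of `B` in `X`. -/
structure IsCollar {X : Type*} [TopologicalSpace X] (B : Set X)
    (h : B × unitInterval → X) : Prop where
  isEmbedding : Topology.IsEmbedding h
  map_zero : ∀ x : B, h (x, 0) = x
  preimage_eq : h ⁻¹' B = {p | p.2 = 0}
  isOpen_image : IsOpen (h '' {p | p.2 < 1})

/-- The closed set `B` is collared in `X`. -/
def IsCollared {X : Type*} [TopologicalSpace X] (B : Set X) : Prop :=
  IsClosed B ∧ ∃ h : B × unitInterval → X, IsCollar B h

/-- The closed set `B` is strongly collared in `X`: it has a collar that is a closed embedding. -/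
def IsStronglyCollared {X : Type*} [TopologicalSpace X] (B : Set X) : Prop :=
  IsClosed B ∧ ∃ h : B × unitInterval → X, IsCollar B h ∧ Topology.IsClosedEmbedding h

/-! ### The long ray and the surface -/

/-- The set of countable ordinals, that is, the ordinal `ω₁` as a set. -/
abbrev OmegaOne : Type 1 := Set.Iio (Ordinal.omega.{0} 1)

/-- The long ray `𝕃_{≥0}`: the set `ω₁ × [0,1)` with the lexicographic order. -/
def LongRay : Type 1 := Lex (OmegaOne × Set.Ico (0 : ℝ) 1)

noncomputable instance : LinearOrder LongRay :=
  inferInstanceAs (LinearOrder (Lex (OmegaOne × Set.Ico (0 : ℝ) 1)))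

/-- The long ray carries the order topology. -/
noncomputable instance : TopologicalSpace LongRay := Preorder.topology LongRay

instance : OrderTopology LongRay := ⟨rfl⟩

namespace LongRay

/-- The point `⟨α, t⟩` of the long ray. -/
def mk (α : OmegaOne) (t : Set.Ico (0 : ℝ) 1) : LongRay := toLex (α, t)

/-- The embedding `α ↦ ⟨α, 0⟩` of `ω₁` in the long ray. -/
def ofOmegaOne (α : OmegaOne) : LongRay := mk α ⟨0, le_refl 0, zero_lt_one⟩

/-- The copy of `ω₁` in the long ray. -/
def omegaOne : Set LongRay := Set.range ofOmegaOne

/-- The end point `⟨0, 0⟩` of the long ray. -/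
noncomputable def origin : LongRay := ofOmegaOne ⟨0, Ordinal.omega_pos 1⟩

/-- The open long ray `𝕃₊`: the long ray without its end point. -/
def openRay : Set LongRay := {origin}ᶜ

end LongRay

/-- The space `𝕃₊ × [0,2) − ω₁ × {0}`, with the subspace topology of `𝕃_{≥0} × ℝ`. -/
def longRaySurface : Set (LongRay × ℝ) :=
  (LongRay.openRay ×ˢ Set.Ico (0 : ℝ) 2) \ (LongRay.omegaOne ×ˢ {(0 : ℝ)})

/-! The heart of the matter is that no collar `h` of the bottom edge is closed. Each bottom segment
is open in the edge, so its `h`-collar contains the point above its midpoint at some height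
`1/(m+1)` (`exists_collar_mem_image`). There are uncountably many segments and countably many
heights, so one `m` serves infinitely many `α`, and these accumulate from below at some `l`
(`exists_infinite_inter_Ioo`). If `h` were closed, then for every `α₀` the image of the collar over
all segments but `α₀` would be closed and would contain `p = (l, 1/(m+1))`. By injectivity the
preimage of `p` would then lie over no segment at all.

The vertical collar, which is not closed, and the height function give the positive claims. Charts
come from unit segments at height `0`, and elsewhere from initial segments of the open ray, which
are real intervals because a countable ordinal carries summable positive weights. Invariance of the
boundary is a winding number argument: in the half-plane, a loop missing a boundary point contracts
in the complement of that point. -/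

open Set Topology

/-! ### Winding numbers and invariance of the boundary -/

/-- There is no homotopy of loops in the circle from a constant loop to the standard loop. -/
theorem Circle.not_exists_nullhomotopy_exp (G : C(unitInterval × ℝ, Circle)) (c : Circle)
    (h0 : ∀ θ, G (0, θ) = c) (h1 : ∀ θ, G (1, θ) = Circle.exp θ)
    (hper : ∀ t, G (t, 0) = G (t, 2 * Real.pi)) : False := by
  have cov := Circle.isCoveringMap_exp
  obtain ⟨e, he⟩ : ∃ e : ℝ, Circle.exp e = c := ⟨_, Circle.exp_arg c⟩
  let L : C(unitInterval × ℝ, ℝ) :=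
    cov.liftHomotopy G (ContinuousMap.const ℝ e) (fun a => by simp [h0, he])
  have hL : ∀ q, Circle.exp (L q) = G q := fun q => congrFun (cov.liftHomotopy_lifts _ _ _) q
  have hL0 : ∀ θ, L (0, θ) = e := fun θ => cov.liftHomotopy_zero _ _ _ θ
  -- Both sides lift the same path and start at `e`. Hence the lift closes up at time `1`, whereas a
  -- lift of the standard loop gains `2π`.
  have ends : (fun t : unitInterval => L (t, 0)) = fun t => L (t, 2 * Real.pi) := by
    refine cov.eq_of_comp_eq (by fun_prop) (by fun_prop) ?_ 0 (by simp [hL0])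
    funext t
    simp [hL, hper]
  have lift1 : (fun θ : ℝ => L (1, θ)) = fun θ => θ + L (1, 0) := by
    refine cov.eq_of_comp_eq (by fun_prop) (by fun_prop) ?_ 0 (by simp)
    funext θ
    simp [hL, h1, Circle.exp_add]
  have h2 : L (1, 0) = L (1, 2 * Real.pi) := congrFun ends 1
  have h3 : L (1, 2 * Real.pi) = 2 * Real.pi + L (1, 0) := congrFun lift1 (2 * Real.pi)
  have := Real.pi_pos
  linarith

/-- The standard loop of radius `r` is not null-homotopic in the punctured complex plane. -/
theorem Complex.not_exists_nullhomotopy_circle {r : ℝ} (hr : 0 < r) (F : unitInterval × ℝ → ℂ)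
    (hF : Continuous F) (hne : ∀ q, F q ≠ 0) (c : ℂ)
    (h0 : ∀ θ, F (0, θ) = c) (h1 : ∀ θ : ℝ, F (1, θ) = r * Complex.exp (θ * Complex.I))
    (hper : ∀ t, F (t, 0) = F (t, 2 * Real.pi)) : False := by
  let N : ∀ z : ℂ, z ≠ 0 → Circle := fun z hz =>
    ⟨z / ‖z‖, mem_sphere_zero_iff_norm.2 (by simp [hz])⟩
  have hN : Continuous fun q => N (F q) (hne q) := by
    refine Continuous.subtype_mk ?_ _
    exact hF.div (by fun_prop) fun q => by simpa using hne q
  have hc : c ≠ 0 := h0 0 ▸ hne _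
  refine Circle.not_exists_nullhomotopy_exp ⟨_, hN⟩ (N c hc) (fun θ => ?_) (fun θ => ?_)
    (fun t => ?_)
  · simp only [ContinuousMap.coe_mk, h0]
  · ext
    have hr' : (r : ℂ) ≠ 0 := by exact_mod_cast hr.ne'
    change F (1, θ) / ‖F (1, θ)‖ = _
    rw [h1, norm_mul, Complex.norm_exp_ofReal_mul_I, Complex.norm_real,
      Real.norm_of_nonneg hr.le, mul_one, Circle.coe_exp]
    field_simp
  · simp only [ContinuousMap.coe_mk, hper]

/-- A point sent by some chart to the boundary of the half-plane has no neighbourhood homeomorphic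
to the plane. -/
theorem mem_manifoldBoundary_of_halfPlane_chart {M : Type*} [TopologicalSpace M] {p : M}
    {W : Set M} (hW : W ∈ 𝓝 p) (ψ : W ≃ₜ EuclideanHalfSpace 2)
    (hp : (ψ ⟨p, mem_of_mem_nhds hW⟩).1 0 = 0) : p ∈ manifoldBoundary 2 M := by
  rintro ⟨N, hN, ⟨f'⟩⟩
  let f : N ≃ₜ ℂ := f'.trans Complex.orthonormalBasisOneI.repr.symm.toHomeomorph
  let pW : W := ⟨p, mem_of_mem_nhds hW⟩
  let pN : N := ⟨p, mem_of_mem_nhds hN⟩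
  let a : EuclideanSpace ℝ (Fin 2) := (ψ pW).1
  obtain ⟨ε, hε, hball⟩ : ∃ ε > 0, ∀ q : EuclideanHalfSpace 2, dist q.1 a < ε →
      (ψ.symm q).1 ∈ N := by
    have hcont : ContinuousAt (fun q => (ψ.symm q).1) (ψ pW) := by fun_prop
    have : (fun q => (ψ.symm q).1) ⁻¹' N ∈ 𝓝 (ψ pW) :=
      hcont (by simpa [pW] using hN)
    rw [show 𝓝 (ψ pW) = Filter.comap Subtype.val (𝓝 a) from nhds_induced _ _] at this
    obtain ⟨V, hV, hVN⟩ := this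
    obtain ⟨ε, hε, h⟩ := Metric.mem_nhds_iff.1 hV
    exact ⟨ε, hε, fun q hq => hVN (h hq)⟩
  -- points near `f pN` come from points of `W` close to `p`
  have hnear : ∀ᶠ z in 𝓝 (f pN), ∃ h : (f.symm z).1 ∈ W, dist (ψ ⟨_, h⟩).1 a < ε := by
    have hc : Filter.Tendsto (fun z => (f.symm z).1) (𝓝 (f pN)) (𝓝 p) := by
      have : ContinuousAt (fun z => (f.symm z).1) (f pN) := by fun_prop
      simpa [ContinuousAt, pN] using this
    have hV : Subtype.val '' {w : W | dist (ψ w).1 a < ε} ∈ 𝓝 p := by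
      have h1 : {w : W | dist (ψ w).1 a < ε} ∈ 𝓝 pW := by
        refine IsOpen.mem_nhds ?_ (by simpa [a] using hε)
        have : Continuous fun w : W => (ψ w).1 := continuous_subtype_val.comp ψ.continuous
        exact isOpen_lt (by fun_prop) continuous_const
      have h2 := Filter.image_mem_map (m := Subtype.val) h1
      rwa [map_nhds_subtype_coe_eq_nhds pW.2 hW] at h2
    filter_upwards [hc hV] with z hz
    obtain ⟨w, hw, hwz⟩ := hz
    have hw' : w = ⟨_, (show (f.symm z).1 ∈ W from by rw [← show w.1 = (f.symm z).1 from hwz]; exact w.2)⟩ :=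
      Subtype.ext hwz
    exact ⟨_, by rw [← hw']; exact hw⟩
  obtain ⟨r, hr, hrball⟩ := Metric.nhds_basis_closedBall.mem_iff.1 hnear
  -- A small circle around the image of `p` in the plane; `k` is the same loop seen in the
  -- half-plane chart.
  let z : ℝ → ℂ := fun θ => f pN + r * Complex.exp (θ * Complex.I)
  have hz : Continuous z := by fun_prop
  have hzr : ∀ θ, z θ ∈ Metric.closedBall (f pN) r := fun θ => by
    simp [z, Complex.norm_exp_ofReal_mul_I, abs_of_pos hr]
  let k : ℝ → EuclideanHalfSpace 2 := fun θ => ψ ⟨_, (hrball (hzr θ)).1⟩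
  have hk : Continuous k :=
    ψ.continuous.comp ((continuous_subtype_val.comp (f.symm.continuous.comp hz)).subtype_mk _)
  have hkd : ∀ θ, dist (k θ).1 a < ε := fun θ => (hrball (hzr θ)).2
  have hka : ∀ θ, (k θ).1 ≠ a := fun θ h => by
    have h1 : k θ = ψ pW := Subtype.ext h
    have h2 : f.symm (z θ) = pN := Subtype.ext (congrArg (fun w : W => (w : M)) (ψ.injective h1))
    have h3 : z θ = f pN := by rw [← h2, f.apply_symm_apply]
    have h4 : (r : ℂ) * Complex.exp (θ * Complex.I) = 0 := by simpa [z] using h3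
    simp [hr.ne'] at h4
  -- Contracting `k` linearly to the interior point `b` keeps coordinate `0` positive until time
  -- `1`, so the homotopy `m` never meets the boundary point `a`.
  let b : EuclideanSpace ℝ (Fin 2) := a + EuclideanSpace.single 0 (ε / 2)
  have hb0 : b 0 = ε / 2 := by
    have : a 0 = 0 := hp
    simp [b, this]
  have hbd : b ∈ Metric.ball a ε := by
    simp [b, abs_of_pos hε]
    linarith
  let m : unitInterval × ℝ → EuclideanSpace ℝ (Fin 2) := fun q =>
    (1 - (q.1 : ℝ)) • b + (q.1 : ℝ) • (k q.2).1
  have hk1 : Continuous fun θ => (k θ).1 := continuous_subtype_val.comp hk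
  have hm : Continuous m := by
    have : Continuous fun q : unitInterval × ℝ => (k q.2).1 := hk1.comp continuous_snd
    fun_prop
  have hm0 : ∀ q, m q 0 = (1 - (q.1 : ℝ)) * (ε / 2) + q.1 * (k q.2).1 0 := fun q => by
    simp [m, hb0]
  have hmH : ∀ q, 0 ≤ m q 0 := fun q => by
    rw [hm0]
    have h1 := q.1.2.1
    have h2 := q.1.2.2
    have h3 := (k q.2).2
    have : 0 ≤ 1 - (q.1 : ℝ) := by linarith
    positivity
  have hma : ∀ q, m q ≠ a := fun q h => by
    have ha : a 0 = 0 := hp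
    have h1 := q.1.2.1
    have h2 := q.1.2.2
    have h3 := (k q.2).2
    have h4 : m q 0 = 0 := by rw [h, ha]
    rw [hm0] at h4
    have h5 : 0 ≤ (1 - (q.1 : ℝ)) * (ε / 2) := mul_nonneg (by linarith) (by linarith)
    have h6 := mul_nonneg h1 h3
    have h7 : (1 - (q.1 : ℝ)) * (ε / 2) = 0 := by linarith
    have h8 : (q.1 : ℝ) = 1 := by
      rcases mul_eq_zero.1 h7 with h | h <;> linarith
    exact hka q.2 (by simpa [m, h8] using h)
  have hmd : ∀ q, dist (m q) a < ε := fun q => by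
    refine (convex_ball a ε) hbd (hkd q.2) ?_ q.1.2.1 (by ring)
    have := q.1.2.2
    linarith
  let mH : unitInterval × ℝ → EuclideanHalfSpace 2 := fun q => ⟨m q, hmH q⟩
  have hmHc : Continuous mH := hm.subtype_mk _
  let F : unitInterval × ℝ → ℂ := fun q => f ⟨(ψ.symm (mH q)).1, hball _ (hmd q)⟩ - f pN
  have hF : Continuous F := by
    refine (f.continuous.comp ?_).sub continuous_const
    exact (continuous_subtype_val.comp (ψ.symm.continuous.comp hmHc)).subtype_mk _
  have hzper : z 0 = z (2 * Real.pi) := by simp [z]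
  have hkper : k 0 = k (2 * Real.pi) := by simp only [k, hzper]
  have hmH1 : ∀ θ, mH (1, θ) = k θ := fun θ => Subtype.ext (by simp [mH, m])
  refine Complex.not_exists_nullhomotopy_circle hr F hF (fun q h => ?_) (F (0, 0)) (fun θ => ?_)
    (fun θ => ?_) (fun t => ?_)
  · have h1 := f.injective (sub_eq_zero.1 h)
    have h2 : ψ.symm (mH q) = pW := Subtype.ext (congrArg (fun w : N => (w : M)) h1)
    have h3 : mH q = ψ pW := by rw [← h2, ψ.apply_symm_apply]
    exact hma q (congrArg Subtype.val h3)
  · have : mH (0, θ) = mH (0, 0) := Subtype.ext (by simp [mH, m])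
    simp only [F, this]
  · have : (⟨(ψ.symm (mH (1, θ))).1, hball _ (hmd _)⟩ : N) = f.symm (z θ) :=
      Subtype.ext (by simp [hmH1, k])
    simp only [F, this]
    simp [z]
  · have : mH (t, 0) = mH (t, 2 * Real.pi) := Subtype.ext (by simp [mH, m, hkper])
    simp only [F, this]

/-! ### Recognising the real line by its order -/

/-- A linear order whose points are the points of a nonempty open real interval is homeomorphic to
the real line. -/
theorem StrictMono.nonempty_homeomorph_real {X : Type*} [LinearOrder X] [TopologicalSpace X]
    [OrderTopology X] {F : X → ℝ} (hF : StrictMono F) {a b : ℝ} (hab : a < b)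
    (hr : range F = Ioo a b) : Nonempty (X ≃ₜ ℝ) := by
  let G : X → ℝ := fun x => 2 * (F x - a) / (b - a) - 1
  have hd : 0 < b - a := sub_pos.2 hab
  have hG : StrictMono G := fun x y hxy => by
    have := hF hxy
    simp only [G]
    gcongr
  have hGr : range G = Ioo (-1) 1 := by
    ext y
    constructor
    · rintro ⟨x, rfl⟩
      have hx : F x ∈ Ioo a b := hr ▸ mem_range_self x
      have h1 := hx.1
      have h2 := hx.2
      constructor
      · have : 0 < 2 * (F x - a) / (b - a) := by
          have : 0 < F x - a := by linarith
          positivity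
        simp only [G]
        linarith
      · have : 2 * (F x - a) / (b - a) < 2 := by
          rw [div_lt_iff₀ hd]
          linarith
        simp only [G]
        linarith
    · rintro ⟨h1, h2⟩
      have : a + (b - a) * (y + 1) / 2 ∈ range F := by
        rw [hr]
        constructor
        · have : 0 < (b - a) * (y + 1) := mul_pos hd (by linarith)
          linarith
        · have : (b - a) * (y + 1) < (b - a) * 2 := by
            gcongr
            linarith
          linarith
      obtain ⟨x, hx⟩ := this
      refine ⟨x, ?_⟩
      simp only [G, hx]
      field_simp
      ring
  exact ⟨((hG.orderIso G).trans ((OrderIso.setCongr _ _ hGr).trans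
    (orderIsoIooNegOneOne ℝ).symm)).toHomeomorph⟩

/-! ### Countable ordinals and summable weights -/

namespace OmegaOne

theorem countable_Iio (β : OmegaOne) : (Iio β).Countable := by
  have h : (Iio β.1).Countable := by
    rw [← Cardinal.le_aleph0_iff_set_countable, Cardinal.mk_Iio_ordinal, ← Cardinal.lift_aleph0.{1, 0},
      Cardinal.lift_le]
    have : β.1 < (Cardinal.aleph 1).ord := by
      rw [Cardinal.ord_aleph]
      exact β.2
    rw [Cardinal.lt_ord] at this
    rwa [← Cardinal.lt_aleph_one_iff]
  exact h.preimage Subtype.val_injective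

theorem uncountable : Uncountable OmegaOne := by
  rw [← Cardinal.aleph0_lt_mk_iff, Cardinal.mk_Iio_ordinal, ← Cardinal.lift_aleph0.{1, 0},
    Cardinal.lift_lt, ← Cardinal.ord_aleph, Cardinal.card_ord]
  exact Cardinal.aleph0_lt_aleph_one

/-- The successor of a countable ordinal. -/
noncomputable def succ (α : OmegaOne) : OmegaOne :=
  ⟨Order.succ α.1, (Cardinal.isSuccLimit_omega 1).succ_lt α.2⟩

theorem lt_succ_iff {α β : OmegaOne} : β < succ α ↔ β ≤ α :=
  Order.lt_succ_iff (α := Ordinal)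

theorem lt_succ (α : OmegaOne) : α < succ α := lt_succ_iff.2 le_rfl

/-- An infinite set of countable ordinals has an accumulation point from below. -/
theorem exists_infinite_inter_Ioo {A : Set OmegaOne} (hA : A.Infinite) :
    ∃ l : OmegaOne, (A ∩ Iio l).Infinite ∧ ∀ δ < l, (A ∩ Ioo δ l).Infinite := by
  have hex : ∃ l : OmegaOne, (A ∩ Iio l).Infinite := by
    let a := hA.natEmbedding
    let μ : OmegaOne := ⟨⨆ n, (a n).1.1, Ordinal.iSup_lt_omega_one fun n => (a n).1.2⟩
    have hμ : ∀ n, (a n).1 ≤ μ := fun n => Ordinal.le_iSup (fun n => (a n).1.1) n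
    refine ⟨succ μ, ?_⟩
    have : (range fun n => (a n).1).Infinite :=
      infinite_range_of_injective (Subtype.val_injective.comp a.injective)
    refine this.mono ?_
    rintro _ ⟨n, rfl⟩
    exact ⟨(a n).2, lt_succ_iff.2 (hμ n)⟩
  -- Minimality makes `A` finite below each `δ < l`, so almost all of the elements of `A` below `l`
  -- lie above `δ`.
  let l := WellFounded.min (wellFounded_lt (α := OmegaOne)) {l | (A ∩ Iio l).Infinite} hex
  have hl : (A ∩ Iio l).Infinite := WellFounded.min_mem _ _ hex
  refine ⟨l, hl, fun δ hδ => ?_⟩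
  have hfin : (A ∩ Iio δ).Finite := by
    by_contra h
    exact WellFounded.not_lt_min wellFounded_lt {l | (A ∩ Iio l).Infinite} h hδ
  have := hl.sdiff (hfin.union (finite_singleton δ))
  refine this.mono ?_
  rintro x ⟨⟨hx, hxl⟩, hn⟩
  simp only [mem_union, mem_inter_iff, mem_Iio, mem_singleton_iff, not_or, not_and, not_lt] at hn
  exact ⟨hx, lt_of_le_of_ne (hn.1 hx) (Ne.symm hn.2), hxl⟩

variable (w : OmegaOne → ℝ)

/-- The total weight of the ordinals in `A`. -/
noncomputable def weight (A : Set OmegaOne) : ℝ := ∑' δ, A.indicator w δ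

variable {w}

theorem weight_mono (hw : Summable w) (h0 : 0 ≤ w) {A B : Set OmegaOne} (h : A ⊆ B) :
    weight w A ≤ weight w B :=
  (hw.indicator A).tsum_le_tsum
    (fun δ => indicator_le_indicator_of_subset h (fun δ => h0 δ) δ) (hw.indicator B)

theorem weight_Iic (hw : Summable w) (γ : OmegaOne) :
    weight w (Iic γ) = weight w (Iio γ) + w γ := by
  have h1 : (Iic γ).indicator w = (Iio γ).indicator w + ({γ} : Set OmegaOne).indicator w := by
    rw [← Iio_union_right]
    exact indicator_union_of_disjoint (disjoint_singleton_right.2 self_notMem_Iio) w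
  have h2 : ∑' δ, ({γ} : Set OmegaOne).indicator w δ = w γ := by
    rw [tsum_eq_single γ fun δ hδ => by simp [hδ]]
    simp
  unfold weight
  rw [h1, ← h2]
  exact (hw.indicator _).tsum_add (hw.indicator _)

/-- Some finite partial sum already exceeds `y`; the largest index in `A` that occurs in it serves
as `m`. Such an index exists because `0 ≤ y`. -/
theorem exists_lt_weight_Iic (hw : Summable w) (h0 : 0 ≤ w) {A : Set OmegaOne} {y : ℝ}
    (hy : 0 ≤ y) (hyA : y < weight w A) : ∃ m ∈ A, y < weight w (Iic m) := by
  classical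
  obtain ⟨s, hs⟩ := ((hw.indicator A).hasSum.eventually (lt_mem_nhds hyA)).exists
  rw [← Finset.sum_filter_add_sum_filter_not s (· ∈ A),
    Finset.sum_eq_zero (s := s.filter (· ∉ A)) fun δ hδ =>
      indicator_of_notMem (Finset.mem_filter.1 hδ).2 w, add_zero] at hs
  have hne : (s.filter (· ∈ A)).Nonempty := by
    rw [Finset.nonempty_iff_ne_empty]
    intro h
    rw [h, Finset.sum_empty] at hs
    linarith
  have hmem := Finset.max'_mem _ hne
  refine ⟨_, (Finset.mem_filter.1 hmem).2, hs.trans_le ?_⟩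
  have : ∑ δ ∈ s.filter (· ∈ A), A.indicator w δ =
      ∑ δ ∈ s.filter (· ∈ A), (Iic ((s.filter (· ∈ A)).max' hne)).indicator w δ := by
    refine Finset.sum_congr rfl fun δ hδ => ?_
    rw [indicator_of_mem (Finset.mem_filter.1 hδ).2, indicator_of_mem (mem_Iic.2 (Finset.le_max' _ _ hδ))]
  rw [this]
  exact (hw.indicator _).sum_le_tsum _ fun δ _ => indicator_nonneg (fun δ _ => h0 δ) δ

/-- Intervals of lengths `w γ`, laid end to end, leave no gap below the total weight: the least `γ`
whose closed initial segment outweighs `y` works. This gives surjectivity when the ray is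
parametrised by weight. -/
theorem exists_weight_Iio_le_lt (hw : Summable w) (h0 : 0 ≤ w) {y : ℝ}
    (hy : 0 ≤ y) (hyT : y < weight w univ) :
    ∃ γ, weight w (Iio γ) ≤ y ∧ y < weight w (Iio γ) + w γ := by
  obtain ⟨m, -, hm⟩ := exists_lt_weight_Iic hw h0 hy hyT
  let γ := WellFounded.min (wellFounded_lt (α := OmegaOne)) {γ | y < weight w (Iic γ)} ⟨m, hm⟩
  have hγ : y < weight w (Iic γ) :=
    WellFounded.min_mem wellFounded_lt {γ | y < weight w (Iic γ)} ⟨m, hm⟩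
  refine ⟨γ, ?_, weight_Iic hw γ ▸ hγ⟩
  by_contra! h
  obtain ⟨δ, hδ, hyδ⟩ := exists_lt_weight_Iic hw h0 hy h
  exact WellFounded.not_lt_min wellFounded_lt {γ | y < weight w (Iic γ)} hyδ hδ

end OmegaOne

/-! ### Order and local structure of the long ray -/

namespace LongRay

open OmegaOne

/-- The ordinal part of a point of the long ray. -/
def fst (x : LongRay) : OmegaOne := (ofLex x).1

/-- The fractional part of a point of the long ray. -/
def snd (x : LongRay) : Ico (0 : ℝ) 1 := (ofLex x).2

theorem mk_fst_snd (x : LongRay) : mk x.fst x.snd = x := rfl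

@[simp] theorem fst_mk (α : OmegaOne) (t : Ico (0 : ℝ) 1) : (mk α t).fst = α := rfl

@[simp] theorem snd_mk (α : OmegaOne) (t : Ico (0 : ℝ) 1) : (mk α t).snd = t := rfl

theorem ext {x y : LongRay} (h1 : x.fst = y.fst) (h2 : x.snd = y.snd) : x = y := by
  rw [← mk_fst_snd x, ← mk_fst_snd y, h1, h2]

theorem lt_iff {x y : LongRay} :
    x < y ↔ x.fst < y.fst ∨ x.fst = y.fst ∧ (x.snd : ℝ) < y.snd :=
  Prod.Lex.lt_iff (α := OmegaOne) (β := Ico (0 : ℝ) 1)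

@[simp] theorem fst_ofOmegaOne (α : OmegaOne) : (ofOmegaOne α).fst = α := rfl

@[simp] theorem coe_snd_ofOmegaOne (α : OmegaOne) : ((ofOmegaOne α).snd : ℝ) = 0 := rfl

theorem lt_ofOmegaOne_iff {x : LongRay} {β : OmegaOne} : x < ofOmegaOne β ↔ x.fst < β := by
  rw [lt_iff, coe_snd_ofOmegaOne, fst_ofOmegaOne]
  have := x.snd.2.1
  constructor
  · rintro (h | h)
    · exact h
    · linarith [h.2]
  · exact Or.inl

theorem ofOmegaOne_lt_iff {x : LongRay} {β : OmegaOne} :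
    ofOmegaOne β < x ↔ β < x.fst ∨ β = x.fst ∧ 0 < (x.snd : ℝ) := by
  rw [lt_iff, coe_snd_ofOmegaOne, fst_ofOmegaOne]

theorem mem_omegaOne_iff {x : LongRay} : x ∈ omegaOne ↔ (x.snd : ℝ) = 0 := by
  constructor
  · rintro ⟨α, rfl⟩
    rfl
  · intro h
    exact ⟨x.fst, ext rfl (Subtype.ext h.symm)⟩

theorem notMem_omegaOne_iff {x : LongRay} : x ∉ omegaOne ↔ 0 < (x.snd : ℝ) := by
  rw [mem_omegaOne_iff]
  exact ⟨fun h => lt_of_le_of_ne x.snd.2.1 (Ne.symm h), fun h => h.ne'⟩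

theorem origin_le (x : LongRay) : origin ≤ x := by
  by_contra! h
  exact absurd (lt_ofOmegaOne_iff.1 h) (by
    rw [not_lt]
    exact bot_le (α := Ordinal))

theorem mem_openRay_iff {x : LongRay} : x ∈ openRay ↔ origin < x := by
  rw [lt_iff_le_and_ne, openRay, mem_compl_singleton_iff]
  exact ⟨fun h => ⟨origin_le x, h.symm⟩, fun h => h.2.symm⟩

/-- The open unit interval between an ordinal and its successor. -/
def unitSegment (α : OmegaOne) : Set LongRay := Ioo (ofOmegaOne α) (ofOmegaOne (succ α))

theorem isOpen_unitSegment (α : OmegaOne) : IsOpen (unitSegment α) := isOpen_Ioo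

theorem mem_unitSegment_iff {α : OmegaOne} {x : LongRay} :
    x ∈ unitSegment α ↔ x.fst = α ∧ x ∉ omegaOne := by
  rw [unitSegment, mem_Ioo, lt_ofOmegaOne_iff, ofOmegaOne_lt_iff, lt_succ_iff, notMem_omegaOne_iff]
  constructor
  · rintro ⟨h | h, h'⟩
    · exact absurd h h'.not_gt
    · exact ⟨h.1.symm, h.2⟩
  · rintro ⟨rfl, h⟩
    exact ⟨.inr ⟨rfl, h⟩, le_rfl⟩

theorem unitSegment_subset (α : OmegaOne) : unitSegment α ⊆ openRay \ omegaOne := fun _ hx =>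
  ⟨mem_openRay_iff.2 ((origin_le _).trans_lt hx.1), (mem_unitSegment_iff.1 hx).2⟩

theorem isClosed_omegaOne : IsClosed omegaOne := by
  have : omegaOneᶜ = ⋃ α, unitSegment α := by
    ext x
    rw [mem_iUnion]
    exact ⟨fun h => ⟨x.fst, mem_unitSegment_iff.2 ⟨rfl, h⟩⟩,
      fun ⟨_, h⟩ => (mem_unitSegment_iff.1 h).2⟩
  rw [← isOpen_compl_iff, this]
  exact isOpen_iUnion isOpen_unitSegment

/-- The segment between an ordinal and its successor is order isomorphic to `(0,1)`. -/
def unitSegmentIso (α : OmegaOne) : unitSegment α ≃o Ioo (0 : ℝ) 1 where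
  toFun x := ⟨x.1.snd, notMem_omegaOne_iff.1 (mem_unitSegment_iff.1 x.2).2, x.1.snd.2.2⟩
  invFun t := ⟨mk α ⟨t, t.2.1.le, t.2.2⟩, mem_unitSegment_iff.2 ⟨rfl, notMem_omegaOne_iff.2 t.2.1⟩⟩
  left_inv x := Subtype.ext (ext (mem_unitSegment_iff.1 x.2).1.symm rfl)
  right_inv _ := rfl
  map_rel_iff' {x y} := by
    have h := (mem_unitSegment_iff.1 x.2).1.trans (mem_unitSegment_iff.1 y.2).1.symm
    rw [← not_lt, ← not_lt, not_iff_not]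
    change (y.1.snd : ℝ) < x.1.snd ↔ y.1 < x.1
    rw [lt_iff]
    simp [h]

instance ordConnected_unitSegment (α : OmegaOne) : OrdConnected (unitSegment α) := ordConnected_Ioo

/-- The segment between an ordinal and its successor is homeomorphic to `(0,1)`. -/
noncomputable def unitSegmentHomeomorph (α : OmegaOne) : unitSegment α ≃ₜ Ioo (0 : ℝ) 1 :=
  (unitSegmentIso α).toHomeomorph

theorem nonempty_unitSegment_homeomorph_real (α : OmegaOne) : Nonempty (unitSegment α ≃ₜ ℝ) := by
  refine StrictMono.nonempty_homeomorph_real (F := fun x => (unitSegmentIso α x : ℝ))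
    (fun x y h => (unitSegmentIso α).strictMono h) zero_lt_one ?_
  change range (Subtype.val ∘ unitSegmentIso α) = _
  rw [range_comp, (unitSegmentIso α).range_eq, image_univ, Subtype.range_coe]

/-- Every proper initial segment of the open long ray is homeomorphic to the real line. -/
theorem nonempty_Ioo_homeomorph_real {β : OmegaOne} (hβ : origin < ofOmegaOne β) :
    Nonempty (Ioo origin (ofOmegaOne β) ≃ₜ ℝ) := by
  obtain ⟨v, hv, c, hc, -⟩ := (OmegaOne.countable_Iio β).exists_pos_hasSum_le zero_lt_one
  let w : OmegaOne → ℝ := (Iio β).indicator v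
  have hw : Summable w := summable_subtype_iff_indicator.1 hc.summable
  have h0 : 0 ≤ w := fun δ => indicator_nonneg (fun δ _ => (hv δ).le) δ
  have hpos : ∀ δ, 0 < w δ ↔ δ < β := fun δ => by
    by_cases h : δ < β
    · simp [w, h, hv]
    · simp [w, h]
  -- The segment after `α` is stretched linearly to length `w α`. As `w` is positive exactly below
  -- `β`, strict monotonicity holds only there.
  let F : LongRay → ℝ := fun x => weight w (Iio x.fst) + x.snd * w x.fst
  have hF1 : ∀ x, x < ofOmegaOne β → F x < weight w (Iic x.fst) := fun x hx => by
    have h1 := (hpos _).2 (lt_ofOmegaOne_iff.1 hx)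
    have h2 : (x.snd : ℝ) * w x.fst < 1 * w x.fst := by
      gcongr
      exact x.snd.2.2
    rw [weight_Iic hw]
    simp only [F]
    linarith
  have hF : StrictMonoOn F (Iio (ofOmegaOne β)) := by
    intro x hx y hy hxy
    rcases lt_iff.1 hxy with h | ⟨h, h'⟩
    · calc F x < weight w (Iic x.fst) := hF1 x hx
        _ ≤ weight w (Iio y.fst) := weight_mono hw h0 (Iic_subset_Iio.2 h)
        _ ≤ F y := le_add_of_nonneg_right (mul_nonneg y.snd.2.1 (h0 _))
    · have h1 := (hpos _).2 (lt_ofOmegaOne_iff.1 hx)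
      simp only [F, ← h]
      gcongr
  have hFo : F origin = 0 := by
    have : Iio origin.fst = ∅ := by
      refine eq_empty_of_forall_notMem fun δ hδ => ?_
      exact not_lt_bot (α := Ordinal) (show δ.1 < 0 from hδ)
    simp only [F, this]
    simp [weight, origin]
  have hT : 0 < weight w univ := by
    rw [← hFo]
    exact (hF1 _ hβ).trans_le (weight_mono hw h0 (subset_univ _))
  refine StrictMono.nonempty_homeomorph_real (F := fun x : Ioo origin (ofOmegaOne β) => F x)
    (fun x y h => hF x.2.2 y.2.2 h) hT ?_
  ext y
  constructor
  · rintro ⟨x, rfl⟩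
    exact ⟨hFo ▸ hF hβ x.2.2 x.2.1,
      (hF1 _ x.2.2).trans_le (weight_mono hw h0 (subset_univ _))⟩
  · rintro ⟨hy0, hyT⟩
    obtain ⟨γ, h1, h2⟩ := exists_weight_Iio_le_lt hw h0 hy0.le hyT
    have hγ : 0 < w γ := by linarith
    let t : Ico (0 : ℝ) 1 := ⟨(y - weight w (Iio γ)) / w γ,
      div_nonneg (by linarith) hγ.le, by rw [div_lt_one hγ]; linarith⟩
    have hFy : F (mk γ t) = y := by
      simp only [F, fst_mk, snd_mk, t]
      field_simp
      ring
    refine ⟨⟨mk γ t, lt_of_le_of_ne (origin_le _) fun h => ?_, ?_⟩, hFy⟩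
    · rw [← h, hFo] at hFy
      linarith
    · exact lt_ofOmegaOne_iff.2 ((hpos γ).1 hγ)

/-- The open long ray is locally homeomorphic to the real line. -/
theorem exists_isOpen_homeomorph_real {x : LongRay} (hx : x ∈ openRay) :
    ∃ U : Set LongRay, IsOpen U ∧ x ∈ U ∧ U ⊆ openRay ∧ Nonempty (U ≃ₜ ℝ) := by
  have h1 := mem_openRay_iff.1 hx
  have h2 : x < ofOmegaOne (succ x.fst) := lt_ofOmegaOne_iff.2 (lt_succ _)
  exact ⟨_, isOpen_Ioo, ⟨h1, h2⟩, fun y hy => mem_openRay_iff.2 hy.1,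
    nonempty_Ioo_homeomorph_real (h1.trans h2)⟩

/-- A closed set that contains the images of points `⟨α, t⟩` for ordinals `α` arbitrarily close to
`l` contains the image of `l`. -/
theorem mem_of_isClosed_of_frequently {X : Type*} [TopologicalSpace X] {Z : Set X}
    (hZ : IsClosed Z) {g : LongRay → X} {l : OmegaOne} (hg : ContinuousAt g (ofOmegaOne l))
    (t : Ico (0 : ℝ) 1) (hl : origin < ofOmegaOne l)
    (h : ∀ δ < l, ∃ α ∈ Ioo δ l, g (mk α t) ∈ Z) : g (ofOmegaOne l) ∈ Z := by
  by_contra hn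
  -- The interval `(x, l]` contains the whole segment after each `α` strictly between `x.fst` and
  -- `l`, so the fractional part `t` is irrelevant.
  obtain ⟨x, hx, hxs⟩ := exists_Ioc_subset_of_mem_nhds (hg (hZ.isOpen_compl.mem_nhds hn))
    ⟨_, hl⟩
  obtain ⟨α, hα, hαZ⟩ := h x.fst (lt_ofOmegaOne_iff.1 hx)
  exact hxs ⟨lt_iff.2 (.inl (show x.fst < (mk α t).fst from hα.1)),
    (lt_ofOmegaOne_iff.2 (show (mk α t).fst < l from hα.2)).le⟩ hαZ

end LongRay

/-! ### Model charts and open parts of collars -/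

/-- The half-open interval `[c, 2)` is homeomorphic to the closed half-line. -/
noncomputable def icoHomeomorphIci {c : ℝ} (hc : c < 2) : Ico c 2 ≃ₜ Ici (0 : ℝ) where
  toFun s := ⟨(s - c) / (2 - s), div_nonneg (sub_nonneg.2 s.2.1) (sub_nonneg.2 s.2.2.le)⟩
  invFun y := ⟨(2 * y + c) / (1 + y), by
    have hy : 0 ≤ (y : ℝ) := y.2
    constructor
    · rw [le_div_iff₀ (by linarith)]
      nlinarith
    · rw [div_lt_iff₀ (by linarith)]
      linarith⟩
  left_inv s := Subtype.ext (by
    have h1 : (2 : ℝ) - s ≠ 0 := by linarith [s.2.2]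
    have h2 : (2 : ℝ) - s + (s - c) ≠ 0 := by linarith
    have h3 : 1 + ((s : ℝ) - c) / (2 - s) ≠ 0 := by
      rw [← div_self h1, ← add_div]
      exact div_ne_zero h2 h1
    simp only
    rw [div_eq_iff h3]
    field_simp
    ring)
  right_inv y := Subtype.ext (by
    have h1 : 1 + (y : ℝ) ≠ 0 := by linarith [show 0 ≤ (y : ℝ) from y.2]
    have h3 : 2 - (2 * (y : ℝ) + c) / (1 + y) ≠ 0 := by
      rw [sub_ne_zero, Ne, eq_div_iff h1]
      intro h
      linarith
    simp only
    rw [div_eq_iff h3]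
    field_simp
    ring)
  continuous_toFun := by
    refine Continuous.subtype_mk (Continuous.div (by fun_prop) (by fun_prop) fun s => ?_) _
    linarith [s.2.2]
  continuous_invFun := by
    refine Continuous.subtype_mk (Continuous.div (by fun_prop) (by fun_prop) fun y => ?_) _
    linarith [show 0 ≤ (y : ℝ) from y.2]

/-- The Euclidean half-plane as a product. -/
noncomputable def halfPlaneHomeomorphProd : EuclideanHalfSpace 2 ≃ₜ ℝ × Ici (0 : ℝ) where
  toFun x := (x.1 1, ⟨x.1 0, x.2⟩)
  invFun q := ⟨!₂[(q.2 : ℝ), q.1], q.2.2⟩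
  left_inv x := Subtype.ext (by
    ext i
    fin_cases i <;> rfl)
  right_inv _ := rfl
  continuous_toFun := by
    have : Continuous fun x : EuclideanHalfSpace 2 => x.1 := continuous_subtype_val
    exact Continuous.prodMk (by fun_prop) (Continuous.subtype_mk (by fun_prop) _)
  continuous_invFun := by
    refine Continuous.subtype_mk ?_ _
    refine (PiLp.continuous_toLp 2 _).comp (continuous_pi fun i => ?_)
    fin_cases i
    · exact continuous_subtype_val.comp continuous_snd
    · exact continuous_fst

/-- The Euclidean plane as a product. -/
noncomputable def euclideanPlaneHomeomorphProd : EuclideanSpace ℝ (Fin 2) ≃ₜ ℝ × ℝ :=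
  Complex.orthonormalBasisOneI.repr.symm.toHomeomorph.trans
    Complex.equivRealProdCLM.toHomeomorph

theorem IsCollar.isOpen_image_inter {X : Type*} [TopologicalSpace X] {B : Set X}
    {h : B × unitInterval → X} (hh : IsCollar B h) {O : Set (B × unitInterval)} (hO : IsOpen O) :
    IsOpen (h '' (O ∩ {p | p.2 < 1})) := by
  obtain ⟨W, hW, rfl⟩ := hh.isEmbedding.isInducing.isOpen_iff.1 hO
  rw [inter_comm, image_inter_preimage]
  exact hh.isOpen_image.inter hW

/-! ### The surface, its boundary and the vertical collar -/

namespace longRaySurface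

open LongRay OmegaOne

theorem mem_iff {x : LongRay} {s : ℝ} : (x, s) ∈ longRaySurface ↔
    x ∈ openRay ∧ 0 ≤ s ∧ s < 2 ∧ (s = 0 → x ∉ omegaOne) := by
  simp only [longRaySurface, mem_sdiff, mem_prod, mem_Ico, mem_singleton_iff, not_and]
  tauto

/-- A box in the surface, as a product. -/
def boxHomeomorph {U : Set LongRay} {V : Set ℝ} (h : U ×ˢ V ⊆ longRaySurface) :
    {p : longRaySurface | p.1 ∈ U ×ˢ V} ≃ₜ U × V where
  toFun p := (⟨p.1.1.1, p.2.1⟩, ⟨p.1.1.2, p.2.2⟩)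
  invFun q := ⟨⟨(q.1, q.2), h ⟨q.1.2, q.2.2⟩⟩, q.1.2, q.2.2⟩
  left_inv _ := rfl
  right_inv _ := rfl
  continuous_toFun := by fun_prop
  continuous_invFun := by fun_prop

/-- The formula for coordinate `0` identifies the points of height `c` as those sent to the edge of
the half-plane. -/
theorem exists_halfPlane_chart {U : Set LongRay} (hU : Nonempty (U ≃ₜ ℝ)) {c : ℝ} (hc : c < 2)
    (h : U ×ˢ Ico c 2 ⊆ longRaySurface) :
    ∃ ψ : {p : longRaySurface | p.1 ∈ U ×ˢ Ico c 2} ≃ₜ EuclideanHalfSpace 2,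
      ∀ p, (ψ p).1 0 = (p.1.1.2 - c) / (2 - p.1.1.2) := by
  obtain ⟨e⟩ := hU
  refine ⟨(boxHomeomorph h).trans
    ((e.prodCongr (icoHomeomorphIci hc)).trans halfPlaneHomeomorphProd.symm), fun p => ?_⟩
  let q := e.prodCongr (icoHomeomorphIci hc) (boxHomeomorph h p)
  exact congrArg (fun q : ℝ × Ici (0 : ℝ) => (q.2 : ℝ)) (halfPlaneHomeomorphProd.apply_symm_apply q)

theorem box_mem_nhds {U : Set LongRay} (hU : IsOpen U) {p : longRaySurface} (hp : p.1.1 ∈ U)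
    {c : ℝ} (hc : c < p.1.2) : {q : longRaySurface | q.1 ∈ U ×ˢ Ico c 2} ∈ 𝓝 p := by
  have h1 : IsOpen {q : longRaySurface | q.1.1 ∈ U ∧ c < q.1.2} :=
    (hU.preimage (by fun_prop)).inter (isOpen_lt continuous_const (continuous_snd.comp continuous_subtype_val))
  filter_upwards [h1.mem_nhds ⟨hp, hc⟩] with q hq
  exact ⟨hq.1, hq.2.le, (mem_iff.1 q.2).2.2.1⟩

theorem box_zero_mem_nhds {U : Set LongRay} (hU : IsOpen U) {p : longRaySurface} (hp : p.1.1 ∈ U) :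
    {q : longRaySurface | q.1 ∈ U ×ˢ Ico 0 2} ∈ 𝓝 p := by
  have h1 : IsOpen {q : longRaySurface | q.1.1 ∈ U} :=
    hU.preimage (continuous_fst.comp continuous_subtype_val)
  filter_upwards [h1.mem_nhds hp] with q hq
  exact ⟨hq, (mem_iff.1 q.2).2.1, (mem_iff.1 q.2).2.2.1⟩

theorem box_subset {U : Set LongRay} (hU : U ⊆ openRay) {V : Set ℝ} (hV : V ⊆ Ioo 0 2) :
    U ×ˢ V ⊆ longRaySurface := fun _ hp =>
  mem_iff.2 ⟨hU hp.1, (hV hp.2).1.le, (hV hp.2).2, fun h => absurd h (hV hp.2).1.ne'⟩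

theorem unitSegment_box_subset (α : OmegaOne) : unitSegment α ×ˢ Ico 0 2 ⊆ longRaySurface :=
  fun _ hp => mem_iff.2 ⟨(unitSegment_subset α hp.1).1, hp.2.1, hp.2.2,
    fun _ => (unitSegment_subset α hp.1).2⟩

theorem isSurface : IsSurface longRaySurface := by
  refine ⟨inferInstance, fun p => ?_⟩
  obtain ⟨hp, h0, h2, hω⟩ := mem_iff.1 p.2
  rcases h0.eq_or_lt with h | h
  · obtain ⟨ψ, -⟩ := exists_halfPlane_chart
      (nonempty_unitSegment_homeomorph_real p.1.1.fst) two_pos (unitSegment_box_subset _)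
    exact ⟨_, box_zero_mem_nhds (isOpen_unitSegment _) (mem_unitSegment_iff.2 ⟨rfl, hω h.symm⟩), ⟨ψ⟩⟩
  · obtain ⟨U, hU, hpU, hUo, hUe⟩ := exists_isOpen_homeomorph_real hp
    -- Half the height of `p` keeps the box away from the deleted points while leaving `p` off its
    -- lower edge.
    obtain ⟨ψ, -⟩ := exists_halfPlane_chart hUe (c := p.1.2 / 2) (by linarith)
      (box_subset hUo fun s hs => ⟨lt_of_lt_of_le (by linarith) hs.1, hs.2⟩)
    exact ⟨_, box_mem_nhds hU hpU (by linarith), ⟨ψ⟩⟩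

/-- The bottom edge of the surface. -/
def bottom : Set longRaySurface := {p | p.1.2 = 0}

theorem bottom_eq : bottom = {p | p.1 ∈ (openRay \ omegaOne) ×ˢ {(0 : ℝ)}} := by
  ext p
  obtain ⟨hp, -, -, hω⟩ := mem_iff.1 p.2
  exact ⟨fun h => ⟨⟨hp, hω h⟩, h⟩, fun h => h.2⟩

theorem manifoldBoundary_eq : manifoldBoundary 2 longRaySurface = bottom := by
  ext p
  obtain ⟨hp, h0, h2, hω⟩ := mem_iff.1 p.2
  constructor
  · intro h
    by_contra hne
    have hpos : 0 < p.1.2 := lt_of_le_of_ne h0 (Ne.symm hne)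
    obtain ⟨U, hU, hpU, hUo, ⟨e⟩⟩ := exists_isOpen_homeomorph_real hp
    obtain ⟨e'⟩ := StrictMono.nonempty_homeomorph_real (X := Ioo (0 : ℝ) 2) (F := Subtype.val)
      (fun _ _ h => h) two_pos Subtype.range_coe
    refine h ⟨{q | q.1 ∈ U ×ˢ Ioo 0 2}, ?_, ⟨(boxHomeomorph (box_subset hUo subset_rfl)).trans
      ((e.prodCongr e').trans euclideanPlaneHomeomorphProd.symm)⟩⟩
    exact (((hU.prod isOpen_Ioo).preimage continuous_subtype_val).mem_nhds ⟨hpU, hpos, h2⟩)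
  · intro (h : p.1.2 = 0)
    obtain ⟨ψ, hψ⟩ := exists_halfPlane_chart
      (nonempty_unitSegment_homeomorph_real p.1.1.fst) two_pos (unitSegment_box_subset _)
    exact mem_manifoldBoundary_of_halfPlane_chart
      (box_zero_mem_nhds (isOpen_unitSegment _) (mem_unitSegment_iff.2 ⟨rfl, hω h⟩)) ψ
      (by simp [hψ, h])

theorem isClosed_bottom : IsClosed bottom := isClosed_eq (by fun_prop) continuous_const

theorem isZeroSet_bottom : IsZeroSet bottom := ⟨fun p => p.1.2, by fun_prop, rfl⟩

theorem notMem_omegaOne_of_mem_bottom (b : bottom) : b.1.1.1 ∉ omegaOne :=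
  (mem_iff.1 b.1.2).2.2.2 b.2

/-- The bottom edge is the disjoint union of its unit segments. -/
noncomputable def sigmaEquivBottom : ((_ : OmegaOne) × Ioo (0 : ℝ) 1) ≃ bottom where
  toFun q := ⟨⟨((unitSegmentIso q.1).symm q.2, 0),
    unitSegment_box_subset q.1 ⟨((unitSegmentIso q.1).symm q.2).2, le_rfl, two_pos⟩⟩, rfl⟩
  invFun b := ⟨b.1.1.1.fst, b.1.1.1.snd,
    notMem_omegaOne_iff.1 (notMem_omegaOne_of_mem_bottom b), b.1.1.1.snd.2.2⟩
  left_inv _ := rfl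
  right_inv b := Subtype.ext (Subtype.ext (Prod.ext rfl (Eq.symm b.2)))

theorem nonempty_bottom_homeomorph_sigma :
    Nonempty (bottom ≃ₜ ((_ : OmegaOne) × Ioo (0 : ℝ) 1)) := by
  have hι : ∀ α, Continuous fun t => ((unitSegmentIso α).symm t).1 := fun α =>
    continuous_subtype_val.comp (unitSegmentHomeomorph α).symm.continuous
  refine ⟨(sigmaEquivBottom.toHomeomorphOfContinuousOpen ?_ ?_).symm⟩
  · refine continuous_sigma fun α => ?_
    exact (((hι α).prodMk continuous_const).subtype_mk _).subtype_mk _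
  · refine isOpenMap_sigma.2 fun α O hO => ?_
    have h1 : IsOpen ((fun t => ((unitSegmentIso α).symm t).1) '' O) :=
      ((isOpen_unitSegment α).isOpenMap_subtype_val.comp
        (unitSegmentHomeomorph α).symm.isOpenMap) O hO
    have h2 : Continuous fun b : bottom => b.1.1.1 := by fun_prop
    convert h1.preimage h2
    ext b
    constructor
    · rintro ⟨t, ht, rfl⟩
      exact ⟨t, ht, rfl⟩
    · rintro ⟨t, ht, hb⟩
      exact ⟨t, ht, Subtype.ext (Subtype.ext (Prod.ext hb (Eq.symm b.2)))⟩

/-- The vertical collar of the bottom edge. -/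
def collar (q : bottom × unitInterval) : longRaySurface :=
  ⟨(q.1.1.1.1, q.2), mem_iff.2 ⟨(mem_iff.1 q.1.1.2).1, q.2.2.1, q.2.2.2.trans_lt one_lt_two,
    fun _ => notMem_omegaOne_of_mem_bottom q.1⟩⟩

theorem isCollar_collar : IsCollar bottom collar where
  isEmbedding := by
    have h1 : IsEmbedding fun b : bottom => b.1.1.1 := by
      have h2 : Continuous fun b : bottom => b.1.1.1 := by fun_prop
      -- On the bottom edge, the first coordinate followed by `x ↦ (x, 0)` is the inclusion.
      have h3 : IsEmbedding fun b : bottom => ((b.1.1.1, 0) : LongRay × ℝ) := by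
        convert IsEmbedding.subtypeVal.comp IsEmbedding.subtypeVal using 1
        funext b
        exact Prod.ext rfl (Eq.symm b.2)
      exact .of_comp h2 (g := fun x => (x, (0 : ℝ))) (by fun_prop) h3
    exact .of_comp (g := Subtype.val) (by unfold collar; fun_prop) continuous_subtype_val
      (h1.prodMap IsEmbedding.subtypeVal)
  map_zero b := Subtype.ext (Prod.ext rfl (Eq.symm b.2))
  preimage_eq := by
    ext q
    exact (Subtype.ext_iff (a1 := q.2) (a2 := 0)).symm
  isOpen_image := by
    have : collar '' {p | p.2 < 1} = {p : longRaySurface | p.1.1 ∈ omegaOneᶜ ∧ p.1.2 < 1} := by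
      ext p
      constructor
      · rintro ⟨q, hq, rfl⟩
        exact ⟨notMem_omegaOne_of_mem_bottom q.1, hq⟩
      · rintro ⟨h1, h2⟩
        obtain ⟨hp, h0, -, -⟩ := mem_iff.1 p.2
        exact ⟨(⟨⟨(p.1.1, 0), mem_iff.2 ⟨hp, le_rfl, two_pos, fun _ => h1⟩⟩, rfl⟩,
          ⟨p.1.2, h0, h2.le⟩), h2, rfl⟩
    rw [this]
    exact (isClosed_omegaOne.isOpen_compl.preimage (continuous_fst.comp continuous_subtype_val)).inter
      (isOpen_lt (continuous_snd.comp continuous_subtype_val) continuous_const)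

/-! ### Failure of strong collaring -/

/-- The midpoint of the unit segment following `α`. -/
noncomputable def midpoint (α : OmegaOne) : LongRay := mk α ⟨1 / 2, by norm_num, by norm_num⟩

theorem midpoint_mem (α : OmegaOne) : midpoint α ∈ unitSegment α :=
  mem_unitSegment_iff.2 ⟨rfl, notMem_omegaOne_iff.2 (by simp [midpoint])⟩

/-- The part of the bottom edge in a unit segment. -/
def bottomSegment (α : OmegaOne) : Set (bottom × unitInterval) := {q | q.1.1.1.1.fst = α}

theorem isOpen_bottomSegment (α : OmegaOne) : IsOpen (bottomSegment α) := by
  have : bottomSegment α = {q | q.1.1.1.1 ∈ unitSegment α} := by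
    ext q
    exact ⟨fun h => mem_unitSegment_iff.2 ⟨h, notMem_omegaOne_of_mem_bottom q.1⟩,
      fun h => (mem_unitSegment_iff.1 h).1⟩
  rw [this]
  exact (isOpen_unitSegment α).preimage (by fun_prop)

/-- The midpoint of a segment, as a point of the bottom edge. -/
noncomputable def bottomMidpoint (α : OmegaOne) : bottom :=
  ⟨⟨(midpoint α, 0), unitSegment_box_subset α ⟨midpoint_mem α, le_rfl, two_pos⟩⟩, rfl⟩

/-- A sequence of heights tending to `0`. -/
noncomputable def height (m : ℕ) : unitInterval :=
  ⟨1 / ((m : ℝ) + 1), by positivity, by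
    rw [div_le_one (by positivity)]
    linarith [Nat.cast_nonneg (α := ℝ) m]⟩

theorem height_pos (m : ℕ) : 0 < (height m : ℝ) := by
  simp only [height]
  positivity

theorem tendsto_height : Filter.Tendsto height Filter.atTop (𝓝 0) :=
  tendsto_subtype_rng.2 tendsto_one_div_add_atTop_nhds_zero_nat

/-- The points above the midpoint converge to it, and `h` maps the part of its half-open collar over
the segment onto an open set containing the midpoint. Restricting to the heights `1/(m+1)` leaves
countably many cases for the pigeonhole. -/
theorem exists_collar_mem_image {h : bottom × unitInterval → longRaySurface}
    (hh : IsCollar bottom h) (α : OmegaOne) :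
    ∃ m, collar (bottomMidpoint α, height m) ∈ h '' bottomSegment α := by
  have h1 : Filter.Tendsto (fun m => collar (bottomMidpoint α, height m)) Filter.atTop
      (𝓝 (bottomMidpoint α).1) := by
    have h2 : Continuous fun s => collar (bottomMidpoint α, s) :=
      isCollar_collar.isEmbedding.continuous.comp (by fun_prop)
    have h3 := (h2.tendsto 0).comp tendsto_height
    rwa [isCollar_collar.map_zero] at h3
  have h4 : (bottomMidpoint α).1 ∈ h '' (bottomSegment α ∩ {p | p.2 < 1}) :=
    ⟨(bottomMidpoint α, 0), ⟨rfl, zero_lt_one (α := unitInterval)⟩, hh.map_zero _⟩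
  obtain ⟨m, hm⟩ :=
    (h1.eventually ((hh.isOpen_image_inter (isOpen_bottomSegment α)).mem_nhds h4)).exists
  exact ⟨m, image_mono inter_subset_left hm⟩

theorem not_isStronglyCollared_bottom : ¬ IsStronglyCollared bottom := by
  rintro ⟨-, h, hh, hcl⟩
  let A : ℕ → Set OmegaOne := fun m =>
    {α | collar (bottomMidpoint α, height m) ∈ h '' bottomSegment α}
  obtain ⟨m, hm⟩ : ∃ m, (A m).Infinite := by
    by_contra! hfin
    have h1 : (⋃ m, A m) = univ := eq_univ_of_forall fun α =>
      mem_iUnion.2 (exists_collar_mem_image hh α)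
    have h2 : (⋃ m, A m).Countable := countable_iUnion fun m => (hfin m).countable
    rw [h1] at h2
    have := OmegaOne.uncountable
    exact not_countable_univ h2
  obtain ⟨l, hl, hacc⟩ := exists_infinite_inter_Ioo hm
  -- An ordinal below `l` shows that `l` is not `0`, so that `p` belongs to the surface.
  obtain ⟨δ, -, hδ⟩ := hl.nonempty
  have hlo : origin < ofOmegaOne l := (origin_le (ofOmegaOne δ)).trans_lt (lt_ofOmegaOne_iff.2 hδ)
  let p : longRaySurface := ⟨(ofOmegaOne l, height m), box_subset subset_rfl subset_rfl
    ⟨mem_openRay_iff.2 hlo, height_pos m, (height m).2.2.trans_lt one_lt_two⟩⟩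
  -- Removing the single index `α₀` leaves infinitely many elements of `A m` in each interval below
  -- `l`, so `p` is still a limit of points in this closed image.
  have key : ∀ α₀, p ∈ h '' (bottomSegment α₀)ᶜ := fun α₀ => by
    have hZ : IsClosed (h '' (bottomSegment α₀)ᶜ) :=
      hcl.isClosedMap _ (isOpen_bottomSegment α₀).isClosed_compl
    obtain ⟨Z, hZc, hZe⟩ := isClosed_induced_iff.1 hZ
    rw [← hZe]
    refine mem_of_isClosed_of_frequently hZc (g := fun x => (x, (height m : ℝ)))
      (by fun_prop) ⟨1 / 2, by norm_num, by norm_num⟩ hlo fun δ hδ => ?_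
    obtain ⟨α, ⟨hαA, hα⟩, hne⟩ := ((hacc δ hδ).sdiff (finite_singleton α₀)).nonempty
    refine ⟨α, hα, ?_⟩
    have h1 : collar (bottomMidpoint α, height m) ∈ h '' (bottomSegment α₀)ᶜ := by
      refine image_mono (fun q hq => ?_) hαA
      exact fun hq' => hne (Eq.trans (Eq.symm hq) hq')
    rw [← hZe] at h1
    exact h1
  -- The index `l` is arbitrary: any one provides a preimage `y`, and `key` is then applied to the
  -- segment containing `y`.
  obtain ⟨y, -, hy⟩ := key l
  obtain ⟨y', hy', hyy⟩ := key y.1.1.1.1.fst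
  have : y' = y := hcl.injective (hyy.trans hy.symm)
  exact hy' (this ▸ rfl)

end longRaySurface

theorem mainTheorem7 :
    IsSurface longRaySurface ∧
    manifoldBoundary 2 longRaySurface =
      {p | p.1 ∈ (LongRay.openRay \ LongRay.omegaOne) ×ˢ {(0 : ℝ)}} ∧
    Nonempty (manifoldBoundary 2 longRaySurface ≃ₜ ((_ : OmegaOne) × Set.Ioo (0 : ℝ) 1)) ∧
    IsCollared (manifoldBoundary 2 longRaySurface) ∧
    IsZeroSet (manifoldBoundary 2 longRaySurface) ∧
    ¬ IsStronglyCollared (manifoldBoundary 2 longRaySurface) := by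
  rw [← longRaySurface.bottom_eq, longRaySurface.manifoldBoundary_eq]
  exact ⟨longRaySurface.isSurface, rfl, longRaySurface.nonempty_bottom_homeomorph_sigma,
    ⟨longRaySurface.isClosed_bottom, _, longRaySurface.isCollar_collar⟩,
    longRaySurface.isZeroSet_bottom, longRaySurface.not_isStronglyCollared_bottom⟩
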